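/- Let $\lambda$ be Lebesgue measure on $[0,1]$, and let $(\Omega,P)=\prod_{n=0}^{\infty}([0,1],\lambda)$. Let $B_1,B_2,\dots$ be pairwise disjoint measurable subsets of $[0,1]$ with $\lambda(B_n)=\frac{1}{e\,n!}$, and let $K:L_1[0,1]\to L_1(\Omega,P)$ be the Kruglov operator $$Kf(\omega_0,\omega_1,\dots)=\sum_{n=1}^{\infty}\sum_{k=1}^{n} f(\omega_k)\,\chi_{B_n}(\omega_0).$$ For a measurable function $f$ on a probability space $(\Sigma,\mu)$ put $f^*(t)=\inf\{s\ge 0:\mu\{|f|>s\}\le t\}$, and for $1\le p<\infty$ let $$\|f\|_{M(t^{1/p})}=\sup_{0<t\le 1}\frac{t^{1/p}}{t}\int_0^t f^*(s)\,ds .$$ For $X=L_p$ or $X=M(t^{1/p})$ let $\|K\|_{X\to X}$ denote the operator norm of $K$ from $X[0,1]$ to $X(\Omega,P)$. There exists an absolute constant $C>0$ (depending neither on $p$ nor on the sets $B_n$) such that for all real $p\ge 1$ $$\|K\|_{L_p\to L_p}\le \frac{Cp}{\ln(p+1)}\qquad\text{and}\qquad \|K\|_{M(t^{1/p})\to M(t^{1/p})}\le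 \frac{Cp}{\ln(p+1)} .$$ -/

import Mathlib

open MeasureTheory ProbabilityTheory
open scoped ENNReal

namespace Kruglov

/-- The probability space `Ω = ∏_{n ≥ 0} [0,1]`, realised as sequences `ω = (ω₀, ω₁, …)`. -/
abbrev Omega : Type := ℕ → unitInterval

/-- The product measure `P = ∏_{n ≥ 0} λ_n`, where each `λ_n` is Lebesgue measure on `[0,1]`. -/
noncomputable def prodMeasure : Measure Omega :=
  Measure.infinitePi (fun _ : ℕ => (volume : Measure unitInterval))

/-- `B₁, B₂, …` are pairwise disjoint (Lebesgue) measurable subsets of `[0,1]` with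
`λ(B_n) = 1 / (e n!)`.  The value `B 0` plays no role. -/
structure IsPoissonSets (B : ℕ → Set unitInterval) : Prop where
  nullMeasurableSet : ∀ n, 1 ≤ n → NullMeasurableSet (B n) volume
  disjoint : ∀ m n, 1 ≤ m → 1 ≤ n → m ≠ n → Disjoint (B m) (B n)
  volume_eq : ∀ n, 1 ≤ n → volume (B n) = ENNReal.ofReal (1 / (Real.exp 1 * (n.factorial : ℝ)))

/-- The `n`-th summand `∑_{k=1}^n f(ω_k) χ_{B_n}(ω₀)` (it vanishes for `n = 0`). -/
noncomputable def kruglovTerm (B : ℕ → Set unitInterval) (f : unitInterval → ℝ) (n : ℕ)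
    (ω : Omega) : ℝ :=
  ∑ k ∈ Finset.Icc 1 n, f (ω k) * (B n).indicator (fun _ => (1 : ℝ)) (ω 0)

/-- `Kf(ω₀, ω₁, …) = ∑_{n ≥ 1} ∑_{k=1}^n f(ω_k) χ_{B_n}(ω₀)` for an everywhere defined function
`f`.  When the `B_n` are disjoint, at most one summand is nonzero at each `ω`. -/
noncomputable def kruglovFun (B : ℕ → Set unitInterval) (f : unitInterval → ℝ) (ω : Omega) : ℝ :=
  ∑' n : ℕ, kruglovTerm B f n ω

instance instIsProbabilityMeasureProdMeasure : IsProbabilityMeasure prodMeasure := by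
  unfold prodMeasure; infer_instance

theorem measurePreserving_eval (k : ℕ) :
    MeasurePreserving (fun ω : Omega => ω k) prodMeasure volume :=
  measurePreserving_eval_infinitePi (fun _ : ℕ => (volume : Measure unitInterval)) k

theorem summable_kruglovTerm {B : ℕ → Set unitInterval} (hB : IsPoissonSets B)
    (f : unitInterval → ℝ) (ω : Omega) : Summable (fun n => kruglovTerm B f n ω) := by
  have hzero : ∀ n, ¬ (1 ≤ n ∧ ω 0 ∈ B n) → kruglovTerm B f n ω = 0 := by
    intro n hn
    unfold kruglovTerm
    refine Finset.sum_eq_zero fun k hk => ?_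
    have h1 : 1 ≤ n := (Finset.mem_Icc.1 hk).1.trans (Finset.mem_Icc.1 hk).2
    have h2 : ω 0 ∉ B n := fun h => hn ⟨h1, h⟩
    simp [h2]
  by_cases h : ∃ m, 1 ≤ m ∧ ω 0 ∈ B m
  · obtain ⟨m, hm1, hm⟩ := h
    refine summable_of_ne_finset_zero (s := {m}) fun n hn => hzero n ?_
    rintro ⟨h1, h2⟩
    have hne : n ≠ m := by simpa using hn
    exact Set.disjoint_left.1 (hB.disjoint n m h1 hm1 hne) h2 hm
  · refine summable_of_ne_finset_zero (s := ∅) fun n _ => hzero n fun h' => h ⟨n, h'⟩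

theorem kruglovFun_add {B : ℕ → Set unitInterval} (hB : IsPoissonSets B)
    (f g : unitInterval → ℝ) :
    kruglovFun B (f + g) = kruglovFun B f + kruglovFun B g := by
  funext ω
  have h : ∀ n, kruglovTerm B (f + g) n ω = kruglovTerm B f n ω + kruglovTerm B g n ω := by
    intro n
    simp [kruglovTerm, add_mul, Finset.sum_add_distrib]
  simp only [kruglovFun, Pi.add_apply, h]
  exact (summable_kruglovTerm hB f ω).tsum_add (summable_kruglovTerm hB g ω)

theorem kruglovFun_smul (B : ℕ → Set unitInterval) (c : ℝ) (f : unitInterval → ℝ) :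
    kruglovFun B (c • f) = c • kruglovFun B f := by
  funext ω
  have h : ∀ n, kruglovTerm B (c • f) n ω = c * kruglovTerm B f n ω := by
    intro n
    simp [kruglovTerm, Finset.mul_sum, mul_assoc]
  simp only [kruglovFun, Pi.smul_apply, smul_eq_mul, h]
  exact tsum_mul_left

theorem kruglovFun_congr (B : ℕ → Set unitInterval) {f g : unitInterval → ℝ}
    (h : f =ᵐ[volume] g) : kruglovFun B f =ᵐ[prodMeasure] kruglovFun B g := by
  have h1 : ∀ᵐ ω ∂prodMeasure, ∀ k : ℕ, f (ω k) = g (ω k) :=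
    ae_all_iff.2 fun k => (measurePreserving_eval k).quasiMeasurePreserving.ae h
  filter_upwards [h1] with ω hω
  simp only [kruglovFun, kruglovTerm, hω]

theorem aemeasurable_indicator {B : ℕ → Set unitInterval} (hB : IsPoissonSets B) {n : ℕ}
    (hn : 1 ≤ n) :
    AEMeasurable ((B n).indicator (fun _ => (1 : ℝ))) (volume : Measure unitInterval) :=
  aemeasurable_const.indicator₀ (hB.nullMeasurableSet n hn)

theorem aestronglyMeasurable_kruglovTerm {B : ℕ → Set unitInterval} (hB : IsPoissonSets B)
    {f : unitInterval → ℝ} (hf : AEStronglyMeasurable f volume) (n : ℕ) :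
    AEStronglyMeasurable (kruglovTerm B f n) prodMeasure := by
  refine AEMeasurable.aestronglyMeasurable ?_
  unfold kruglovTerm
  refine Finset.aemeasurable_fun_sum _ fun k hk => ?_
  have h1 : 1 ≤ n := (Finset.mem_Icc.1 hk).1.trans (Finset.mem_Icc.1 hk).2
  exact (hf.aemeasurable.comp_quasiMeasurePreserving
      (measurePreserving_eval k).quasiMeasurePreserving).mul
    ((aemeasurable_indicator hB h1).comp_quasiMeasurePreserving
      (measurePreserving_eval 0).quasiMeasurePreserving)

theorem aestronglyMeasurable_kruglovFun {B : ℕ → Set unitInterval} (hB : IsPoissonSets B)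
    {f : unitInterval → ℝ} (hf : AEStronglyMeasurable f volume) :
    AEStronglyMeasurable (kruglovFun B f) prodMeasure := by
  refine aestronglyMeasurable_of_tendsto_ae (u := Filter.atTop)
    (f := fun N : ℕ => fun ω => ∑ n ∈ Finset.range N, kruglovTerm B f n ω) (fun N => ?_) ?_
  · exact Finset.aestronglyMeasurable_fun_sum _
      fun n _ => aestronglyMeasurable_kruglovTerm hB hf n
  · exact Filter.Eventually.of_forall fun ω =>
      (summable_kruglovTerm hB f ω).hasSum.tendsto_sum_nat

theorem lintegral_kruglovTerm_le {B : ℕ → Set unitInterval} (hB : IsPoissonSets B)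
    {f : unitInterval → ℝ} (hf : AEStronglyMeasurable f volume) (n : ℕ) :
    ∫⁻ ω, ‖kruglovTerm B f n ω‖ₑ ∂prodMeasure
      ≤ ENNReal.ofReal (n * (1 / (Real.exp 1 * (n.factorial : ℝ)))) * ∫⁻ x, ‖f x‖ₑ := by
  have hterm : ∀ k ∈ Finset.Icc 1 n,
      ∫⁻ ω, ‖f (ω k)‖ₑ * ‖(B n).indicator (fun _ => (1 : ℝ)) (ω 0)‖ₑ ∂prodMeasure
        = (∫⁻ x, ‖f x‖ₑ) * ENNReal.ofReal (1 / (Real.exp 1 * (n.factorial : ℝ))) := by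
    intro k hk
    have hk1 := (Finset.mem_Icc.1 hk).1
    have h1 : 1 ≤ n := hk1.trans (Finset.mem_Icc.1 hk).2
    have hF : AEMeasurable (fun x => ‖f x‖ₑ) (volume : Measure unitInterval) :=
      hf.aemeasurable.enorm
    have hG : AEMeasurable (fun x => ‖(B n).indicator (fun _ => (1 : ℝ)) x‖ₑ)
        (volume : Measure unitInterval) := (aemeasurable_indicator hB h1).enorm
    have hind : IndepFun (fun ω : Omega => ω k) (fun ω : Omega => ω 0) prodMeasure :=
      (iIndepFun_infinitePi (P := fun _ : ℕ => (volume : Measure unitInterval))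
        (X := fun _ x => x) (fun _ => measurable_id)).indepFun (by omega)
    have hk' := measurePreserving_eval k
    have h0' := measurePreserving_eval 0
    have hind2 : IndepFun (fun ω : Omega => ‖f (ω k)‖ₑ)
        (fun ω : Omega => ‖(B n).indicator (fun _ => (1 : ℝ)) (ω 0)‖ₑ) prodMeasure :=
      IndepFun.comp₀ (φ := fun x => ‖f x‖ₑ)
        (ψ := fun x => ‖(B n).indicator (fun _ => (1 : ℝ)) x‖ₑ)
        hind hk'.aemeasurable h0'.aemeasurable (by rw [hk'.map_eq]; exact hF)
        (by rw [h0'.map_eq]; exact hG)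
    have e := lintegral_mul_eq_lintegral_mul_lintegral_of_indepFun''
      (hF.comp_quasiMeasurePreserving hk'.quasiMeasurePreserving)
      (hG.comp_quasiMeasurePreserving h0'.quasiMeasurePreserving) hind2
    refine Eq.trans e ?_
    congr 1
    · have := lintegral_map' (μ := prodMeasure) (g := fun ω : Omega => ω k)
        (by rw [hk'.map_eq]; exact hF) hk'.aemeasurable
      rw [hk'.map_eq] at this
      exact this.symm
    · have := lintegral_map' (μ := prodMeasure) (g := fun ω : Omega => ω 0)
        (by rw [h0'.map_eq]; exact hG) h0'.aemeasurable
      rw [h0'.map_eq] at this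
      refine this.symm.trans ?_
      rw [← hB.volume_eq n h1, ← lintegral_indicator_one₀ (hB.nullMeasurableSet n h1)]
      refine lintegral_congr fun x => ?_
      by_cases hx : x ∈ B n <;> simp [hx]
  calc ∫⁻ ω, ‖kruglovTerm B f n ω‖ₑ ∂prodMeasure
      ≤ ∫⁻ ω, ∑ k ∈ Finset.Icc 1 n,
          ‖f (ω k)‖ₑ * ‖(B n).indicator (fun _ => (1 : ℝ)) (ω 0)‖ₑ ∂prodMeasure := by
        refine lintegral_mono fun ω => ?_
        refine (enorm_sum_le _ _).trans (le_of_eq ?_)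
        exact Finset.sum_congr rfl fun k _ => enorm_mul _ _
    _ = ∑ k ∈ Finset.Icc 1 n, ∫⁻ ω,
          ‖f (ω k)‖ₑ * ‖(B n).indicator (fun _ => (1 : ℝ)) (ω 0)‖ₑ ∂prodMeasure := by
        refine lintegral_finsetSum' _ fun k hk => ?_
        have h1 : 1 ≤ n := (Finset.mem_Icc.1 hk).1.trans (Finset.mem_Icc.1 hk).2
        exact (hf.aemeasurable.comp_quasiMeasurePreserving
            (measurePreserving_eval k).quasiMeasurePreserving).enorm.mul
          ((aemeasurable_indicator hB h1).comp_quasiMeasurePreserving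
            (measurePreserving_eval 0).quasiMeasurePreserving).enorm
    _ = ENNReal.ofReal (n * (1 / (Real.exp 1 * (n.factorial : ℝ)))) * ∫⁻ x, ‖f x‖ₑ := by
        rw [Finset.sum_congr rfl hterm, Finset.sum_const, Nat.card_Icc, nsmul_eq_mul,
          ENNReal.ofReal_mul (by positivity), ENNReal.ofReal_natCast]
        simp only [Nat.add_sub_cancel]
        ring
    _ ≤ _ := le_rfl

theorem summable_weights : Summable fun n : ℕ => (n : ℝ) * (1 / (Real.exp 1 * (n.factorial : ℝ))) := by
  have h : Summable fun n : ℕ => ((n + 1 : ℕ) : ℝ) * (1 / (Real.exp 1 * ((n + 1).factorial : ℝ))) := by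
    have h0 := (Real.summable_pow_div_factorial 1).mul_left (1 / Real.exp 1)
    refine h0.congr fun n => ?_
    have : (n.factorial : ℝ) ≠ 0 := by positivity
    rw [Nat.factorial_succ]
    push_cast
    field_simp
    simp
  exact (summable_nat_add_iff 1).1 h

theorem integrable_kruglovFun {B : ℕ → Set unitInterval} (hB : IsPoissonSets B)
    {f : unitInterval → ℝ} (hf : Integrable f volume) :
    Integrable (kruglovFun B f) prodMeasure := by
  refine ⟨aestronglyMeasurable_kruglovFun hB hf.1, ?_⟩
  rw [hasFiniteIntegral_iff_enorm]
  calc ∫⁻ ω, ‖kruglovFun B f ω‖ₑ ∂prodMeasure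
      ≤ ∫⁻ ω, ∑' n, ‖kruglovTerm B f n ω‖ₑ ∂prodMeasure :=
        lintegral_mono fun ω => enorm_tsum_le_tsum_enorm
    _ = ∑' n, ∫⁻ ω, ‖kruglovTerm B f n ω‖ₑ ∂prodMeasure :=
        lintegral_tsum fun n => (aestronglyMeasurable_kruglovTerm hB hf.1 n).enorm
    _ ≤ ∑' n : ℕ, ENNReal.ofReal (n * (1 / (Real.exp 1 * (n.factorial : ℝ)))) * ∫⁻ x, ‖f x‖ₑ :=
        ENNReal.tsum_le_tsum fun n => lintegral_kruglovTerm_le hB hf.1 n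
    _ < ∞ := by
        rw [ENNReal.tsum_mul_right]
        refine ENNReal.mul_lt_top ?_ (hasFiniteIntegral_iff_enorm.1 hf.2)
        exact lt_of_le_of_ne le_top summable_weights.tsum_ofReal_ne_top

/-- The Kruglov operator `K : L₁[0,1] → L₁(Ω, P)` built from the sets `B_n`, as a linear map:
`Kf` is the class of `∑_{n ≥ 1} ∑_{k=1}^n f(ω_k) χ_{B_n}(ω₀)`. -/
noncomputable def kruglov (B : ℕ → Set unitInterval) (hB : IsPoissonSets B) :
    Lp ℝ 1 (volume : Measure unitInterval) →ₗ[ℝ] Lp ℝ 1 prodMeasure where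
  toFun f := (integrable_kruglovFun hB (L1.integrable_coeFn f)).toL1 (kruglovFun B f)
  map_add' f g := by
    rw [← Integrable.toL1_add, Integrable.toL1_eq_toL1_iff, ← kruglovFun_add hB]
    exact kruglovFun_congr B (Lp.coeFn_add f g)
  map_smul' c f := by
    rw [RingHom.id_apply, ← Integrable.toL1_smul, Integrable.toL1_eq_toL1_iff]
    have h := kruglovFun_smul B c f
    exact (kruglovFun_congr B (Lp.coeFn_smul c f)).trans (Filter.EventuallyEq.of_eq h)

/-- The decreasing rearrangement `f*(t) = inf {s ≥ 0 : μ {|f| > s} ≤ t}`.  On an atomless space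
this is the same as the infimum, over sets `A` with `μ A = t`, of the supremum of `|f|` off `A`. -/
noncomputable def rearrangement {α : Type*} [MeasurableSpace α] (μ : Measure α) (f : α → ℝ)
    (t : ℝ) : ℝ≥0∞ :=
  sInf {s : ℝ≥0∞ | μ {x | s < ‖f x‖ₑ} ≤ ENNReal.ofReal t}

/-- The norm of the Marcinkiewicz space `M(ψ)` over a probability space `(α, μ)`:
`‖f‖_{M(ψ)} = sup_{0 < t ≤ 1} (ψ(t)/t) ∫₀ᵗ f*(s) ds ∈ [0, ∞]`. -/
noncomputable def marcinkiewiczNorm {α : Type*} [MeasurableSpace α] (μ : Measure α) (ψ : ℝ → ℝ)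
    (f : α → ℝ) : ℝ≥0∞ :=
  ⨆ t ∈ Set.Ioc (0 : ℝ) 1,
    ENNReal.ofReal (ψ t / t) * ∫⁻ s in Set.Ioc (0 : ℝ) t, rearrangement μ f s

/-- The operator norm `‖T‖_{X → Y} ∈ [0, ∞]` of a linear map `T : L₁(α, μ) → L₁(β, ν)`, for
spaces `X = {f ∈ L₁(μ) : NX f < ∞}` and `Y = {g ∈ L₁(ν) : NY g < ∞}` given by `[0, ∞]`-valued
norms: the least `c` with `‖T f‖_Y ≤ c ‖f‖_X` for all `f ∈ X`.  It is finite exactly when `T`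
maps `X` boundedly into `Y`. -/
noncomputable def opNorm {α β : Type*} [MeasurableSpace α] [MeasurableSpace β] {μ : Measure α}
    {ν : Measure β} (NX : (α → ℝ) → ℝ≥0∞) (NY : (β → ℝ) → ℝ≥0∞)
    (T : Lp ℝ 1 μ →ₗ[ℝ] Lp ℝ 1 ν) : ℝ≥0∞ :=
  sInf {c : ℝ≥0∞ | ∀ f : Lp ℝ 1 μ, NX f < ∞ → NY (T f) ≤ c * NX f}

/-- `‖K‖_{L_p → L_p}`. -/
noncomputable def kruglovNormLp (B : ℕ → Set unitInterval) (hB : IsPoissonSets B) (p : ℝ) :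
    ℝ≥0∞ :=
  opNorm (fun f => eLpNorm f (ENNReal.ofReal p) volume)
    (fun g => eLpNorm g (ENNReal.ofReal p) prodMeasure) (kruglov B hB)

/-- `‖K‖_{M(ψ) → M(ψ)}`. -/
noncomputable def kruglovNormMarcinkiewicz (B : ℕ → Set unitInterval) (hB : IsPoissonSets B)
    (ψ : ℝ → ℝ) : ℝ≥0∞ :=
  opNorm (marcinkiewiczNorm volume ψ) (marcinkiewiczNorm prodMeasure ψ) (kruglov B hB)

end Kruglov

namespace Kruglov

/-! ### Equidistribution of the decreasing rearrangement -/

/-! On $\{\omega_0\in B_n\}$ the function $Kf$ is a sum of $n$ copies of $f$. For increasing convex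
$\varphi$ with $\varphi(0)=0$, Jensen's inequality gives $\varphi(|\sum_{k\le n} f(\omega_k)|)\le
\frac1n\sum_{k\le n}\varphi(n|f(\omega_k)|)$. Each $\omega_k$ with $k\ge1$ is independent of
$\omega_0$, so $E\varphi(|Kf|)\le E\varphi(N|f|)$, where $N$ is a Poisson(1) variable independent of
$f$ (`lintegral_comp_enorm_kruglovFun_le`). Independence among the $\omega_k$ with $k\ge1$ plays no
role.

Both norms then reduce to the moment bound $E N^p\le M^p$ with $M=p/\ln(p+1)$
(`tsum_weight_mul_rpow_le`), and $C=1$ suffices. For $L_p$ take $\varphi(y)=y^p$.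

For $M(t^{1/p})$ take $\varphi(y)=(y-S)_+$ and use $\int_0^t g^*\le St+E(|g|-S)_+$. A level-set
estimate combined with Young's inequality bounds $\int(n|f|-S)_+$ by a multiple of $n^p$
(`lintegral_natCast_mul_enorm_tsub_le`); summation over $n$ again produces $E N^p$, and $S$ is tuned
to $t$. -/

theorem lt_rearrangement_iff {α : Type*} [MeasurableSpace α] (μ : Measure α) (f : α → ℝ)
    (t : ℝ) (s : ℝ≥0∞) :
    s < rearrangement μ f t ↔ ENNReal.ofReal t < μ {x | s < ‖f x‖ₑ} := by
  constructor
  · intro h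
    by_contra! hle
    exact absurd (sInf_le hle : rearrangement μ f t ≤ s) (not_le.2 h)
  -- The distribution function $s\mapsto\mu\{|f|>s\}$ is right continuous: a slightly larger level
  -- still has measure above $t$, which keeps the infimum strictly above $s$.
  · intro h
    have hs : s ≠ ∞ := by
      rintro rfl
      simp at h
    obtain ⟨u, hu, hus, hlim⟩ := exists_seq_strictAnti_tendsto' hs.lt_top
    have hset : {x | s < ‖f x‖ₑ} = ⋃ n, {x | u n < ‖f x‖ₑ} := by
      ext x
      simp only [Set.mem_ofPred_eq, Set.mem_iUnion]
      constructor
      · intro hx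
        exact (hlim.eventually_lt_const hx).exists
      · rintro ⟨n, hn⟩
        exact (hus n).1.trans hn
    have hmono : Monotone fun n => {x | u n < ‖f x‖ₑ} := fun m n hmn x hx =>
      (hu.antitone hmn).trans_lt hx
    rw [hset, hmono.measure_iUnion, lt_iSup_iff] at h
    obtain ⟨n, hn⟩ := h
    refine (hus n).1.trans_le (le_sInf fun r hr => ?_)
    by_contra! hlt
    exact absurd (hn.trans_le (measure_mono fun x hx => hlt.trans hx)) (not_lt.2 hr)

theorem antitone_rearrangement {α : Type*} [MeasurableSpace α] (μ : Measure α) (f : α → ℝ) :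
    Antitone (rearrangement μ f) := fun _ _ hst =>
  sInf_le_sInf fun _ hr => le_trans hr (ENNReal.ofReal_le_ofReal hst)

/-- Inside $(0,1]$ the set $\{f^*>s\}$ is the interval $(0,\mu\{|f|>s\})$ up to its right endpoint,
and the measures of these sets determine a law on $[0,\infty]$. -/
theorem map_rearrangement {α : Type*} [MeasurableSpace α] (μ : Measure α) [IsProbabilityMeasure μ]
    {f : α → ℝ} (hf : AEMeasurable f μ) :
    Measure.map (rearrangement μ f) (volume.restrict (Set.Ioc 0 1))
      = Measure.map (fun x => ‖f x‖ₑ) μ := by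
  have hm := (antitone_rearrangement μ f).measurable
  have hp : IsProbabilityMeasure (volume.restrict (Set.Ioc (0 : ℝ) 1)) := ⟨by simp⟩
  have h1 := Measure.isProbabilityMeasure_map (μ := volume.restrict (Set.Ioc (0 : ℝ) 1))
    hm.aemeasurable
  have h2 := Measure.isProbabilityMeasure_map hf.enorm
  refine Measure.ext_of_Iic _ _ fun s => ?_
  rw [← Set.compl_Ioi, prob_compl_eq_one_sub measurableSet_Ioi,
    prob_compl_eq_one_sub measurableSet_Ioi, Measure.map_apply hm measurableSet_Ioi,
    Measure.map_apply_of_aemeasurable hf.enorm measurableSet_Ioi,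
    Measure.restrict_apply (hm measurableSet_Ioi)]
  congr 1
  set τ := μ {x | s < ‖f x‖ₑ} with hτ
  have hτ1 : τ ≤ 1 := prob_le_one
  have hτt : τ ≠ ∞ := (hτ1.trans_lt ENNReal.one_lt_top).ne
  have hset : rearrangement μ f ⁻¹' Set.Ioi s ∩ Set.Ioc 0 1 = Set.Ioo 0 τ.toReal := by
    ext t
    simp only [Set.mem_inter_iff, Set.mem_preimage, Set.mem_Ioi, lt_rearrangement_iff,
      Set.mem_Ioc, Set.mem_Ioo, ← hτ]
    have h3 : τ.toReal ≤ 1 := ENNReal.toReal_le_of_le_ofReal zero_le_one (by simpa using hτ1)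
    constructor
    · rintro ⟨h, h0, -⟩
      exact ⟨h0, (ENNReal.ofReal_lt_iff_lt_toReal h0.le hτt).1 h⟩
    · rintro ⟨h0, h⟩
      exact ⟨(ENNReal.ofReal_lt_iff_lt_toReal h0.le hτt).2 h, h0, h.le.trans h3⟩
  rw [hset, Real.volume_Ioo, sub_zero, ENNReal.ofReal_toReal hτt]
  rfl

theorem lintegral_comp_rearrangement {α : Type*} [MeasurableSpace α] (μ : Measure α)
    [IsProbabilityMeasure μ] {f : α → ℝ} (hf : AEMeasurable f μ) {φ : ℝ≥0∞ → ℝ≥0∞}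
    (hφ : Measurable φ) :
    ∫⁻ s in Set.Ioc (0 : ℝ) 1, φ (rearrangement μ f s) = ∫⁻ x, φ ‖f x‖ₑ ∂μ := by
  rw [← lintegral_map hφ (antitone_rearrangement μ f).measurable, map_rearrangement μ hf,
    lintegral_map' hφ.aemeasurable hf.enorm]

/-- This comes from $f^*\le S+(f^*-S)_+$ and equidistribution. It replaces the rearrangement of $Kf$
by a convex function of $|Kf|$, with $S$ left free. -/
theorem setLIntegral_rearrangement_le {α : Type*} [MeasurableSpace α] (μ : Measure α)
    [IsProbabilityMeasure μ] {f : α → ℝ} (hf : AEMeasurable f μ) {t : ℝ} (ht : t ≤ 1)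
    (S : ℝ≥0∞) :
    ∫⁻ s in Set.Ioc (0 : ℝ) t, rearrangement μ f s
      ≤ S * ENNReal.ofReal t + ∫⁻ x, (‖f x‖ₑ - S) ∂μ := by
  rw [← lintegral_comp_rearrangement μ hf (φ := fun y => y - S) (by fun_prop)]
  calc ∫⁻ s in Set.Ioc (0 : ℝ) t, rearrangement μ f s
      ≤ ∫⁻ s in Set.Ioc (0 : ℝ) t, (S + (rearrangement μ f s - S)) :=
        lintegral_mono fun s => le_add_tsub
    _ = S * ENNReal.ofReal t + ∫⁻ s in Set.Ioc (0 : ℝ) t, (rearrangement μ f s - S) := by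
        rw [lintegral_add_left measurable_const]
        simp
    _ ≤ _ := by
        gcongr

/-- Equidistribution applied to $y\mapsto y\,1_{y>s}$ turns the level set into an initial interval,
since $f^*(u)>s$ forces $u<\mu\{|f|>s\}$. -/
theorem setLIntegral_enorm_le {α : Type*} [MeasurableSpace α] (μ : Measure α)
    [IsProbabilityMeasure μ] {f : α → ℝ} (hf : AEMeasurable f μ) (s : ℝ≥0∞) :
    ∫⁻ x in {x | s < ‖f x‖ₑ}, ‖f x‖ₑ ∂μ
      ≤ ∫⁻ u in Set.Ioc (0 : ℝ) (μ {x | s < ‖f x‖ₑ}).toReal, rearrangement μ f u := by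
  have hφ : Measurable ((Set.Ioi s).indicator (fun y : ℝ≥0∞ => y)) :=
    measurable_id.indicator measurableSet_Ioi
  have hm := (antitone_rearrangement μ f).measurable
  have hns : NullMeasurableSet {x | s < ‖f x‖ₑ} μ := nullMeasurableSet_lt aemeasurable_const hf.enorm
  calc ∫⁻ x in {x | s < ‖f x‖ₑ}, ‖f x‖ₑ ∂μ
      = ∫⁻ x, (Set.Ioi s).indicator (fun y : ℝ≥0∞ => y) ‖f x‖ₑ ∂μ := by
        rw [← lintegral_indicator₀ hns]
        rfl
    _ = ∫⁻ u in Set.Ioc (0 : ℝ) 1,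
          (Set.Ioi s).indicator (fun y : ℝ≥0∞ => y) (rearrangement μ f u) :=
        (lintegral_comp_rearrangement μ hf hφ).symm
    _ ≤ ∫⁻ u in Set.Ioc (0 : ℝ) 1,
          (Set.Ioc (0 : ℝ) (μ {x | s < ‖f x‖ₑ}).toReal).indicator (rearrangement μ f) u := by
        refine setLIntegral_mono' measurableSet_Ioc fun u hu => ?_
        by_cases h : s < rearrangement μ f u
        · have h' := (ENNReal.ofReal_lt_iff_lt_toReal hu.1.le (measure_ne_top _ _)).1
            ((lt_rearrangement_iff μ f u s).1 h)
          rw [Set.indicator_of_mem (show _ ∈ Set.Ioi s from h),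
            Set.indicator_of_mem (show u ∈ Set.Ioc (0 : ℝ) _ from ⟨hu.1, h'.le⟩)]
        · rw [Set.indicator_of_notMem (show _ ∉ Set.Ioi s from h)]
          exact zero_le
    _ ≤ ∫⁻ u, (Set.Ioc (0 : ℝ) (μ {x | s < ‖f x‖ₑ}).toReal).indicator (rearrangement μ f) u :=
        setLIntegral_le_lintegral _ _
    _ = _ := lintegral_indicator measurableSet_Ioc _

theorem marcinkiewiczNorm_congr_ae {α : Type*} [MeasurableSpace α] {μ : Measure α} (ψ : ℝ → ℝ)
    {f g : α → ℝ} (h : f =ᵐ[μ] g) : marcinkiewiczNorm μ ψ f = marcinkiewiczNorm μ ψ g := by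
  have : rearrangement μ f = rearrangement μ g := by
    funext t
    unfold rearrangement
    congr 1
    ext s
    have : μ {x | s < ‖f x‖ₑ} = μ {x | s < ‖g x‖ₑ} := by
      refine measure_congr ?_
      filter_upwards [h] with x hx
      exact propext (show s < ‖f x‖ₑ ↔ s < ‖g x‖ₑ by rw [hx])
    simp only [Set.mem_ofPred_eq, this]
  simp only [marcinkiewiczNorm, this]

/-- Over a set where `|f|` exceeds a level, `∫ |f|` is controlled by the Marcinkiewicz norm. -/
theorem setLIntegral_enorm_le_marcinkiewiczNorm {α : Type*} [MeasurableSpace α] (μ : Measure α)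
    [IsProbabilityMeasure μ] {f : α → ℝ} (hf : AEMeasurable f μ) (p : ℝ)
    (s : ℝ≥0∞) :
    ∫⁻ x in {x | s < ‖f x‖ₑ}, ‖f x‖ₑ ∂μ
      ≤ marcinkiewiczNorm μ (fun t => t ^ (1 / p)) f
        * ENNReal.ofReal ((μ {x | s < ‖f x‖ₑ}).toReal ^ (1 - 1 / p)) := by
  set τ := (μ {x | s < ‖f x‖ₑ}).toReal with hτ
  -- The supremum defining the norm omits $t=0$, so a null level set is treated separately.
  rcases eq_or_lt_of_le (ENNReal.toReal_nonneg : 0 ≤ τ) with h0 | h0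
  · have : μ {x | s < ‖f x‖ₑ} = 0 := by
      rw [← hτ, eq_comm, ENNReal.toReal_eq_zero_iff] at h0
      exact h0.resolve_right (measure_ne_top _ _)
    rw [setLIntegral_measure_zero _ _ this]
    exact zero_le
  · replace h0 : 0 < τ := h0
    have h1 : τ ≤ 1 := ENNReal.toReal_le_of_le_ofReal zero_le_one (by simpa using prob_le_one)
    refine (setLIntegral_enorm_le μ hf s).trans ?_
    have hsup : ENNReal.ofReal (τ ^ (1 / p) / τ) * ∫⁻ u in Set.Ioc (0 : ℝ) τ, rearrangement μ f u
        ≤ marcinkiewiczNorm μ (fun t => t ^ (1 / p)) f :=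
      le_iSup₂_of_le (f := fun t (_ : t ∈ Set.Ioc (0 : ℝ) 1) =>
        ENNReal.ofReal (t ^ (1 / p) / t) * ∫⁻ s in Set.Ioc (0 : ℝ) t, rearrangement μ f s)
        τ ⟨h0, h1⟩ le_rfl
    have hone : ENNReal.ofReal (τ ^ (1 / p) / τ) * ENNReal.ofReal (τ ^ (1 - 1 / p)) = 1 := by
      rw [← ENNReal.ofReal_mul (by positivity), Real.rpow_sub h0, Real.rpow_one,
        ← ENNReal.ofReal_one]
      congr 1
      have := (Real.rpow_pos_of_pos h0 (1 / p)).ne'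
      field_simp
    calc _ = (ENNReal.ofReal (τ ^ (1 / p) / τ) *
          ∫⁻ u in Set.Ioc (0 : ℝ) τ, rearrangement μ f u) * ENNReal.ofReal (τ ^ (1 - 1 / p)) := by
          rw [mul_right_comm, hone, one_mul]
      _ ≤ _ := by gcongr

/-! ### Moments of the Poisson weights -/

/-- The masses `1 / (e n!)` of the sets `B_n`. -/
noncomputable def weight (n : ℕ) : ℝ≥0∞ := ENNReal.ofReal (1 / (Real.exp 1 * (n.factorial : ℝ)))

/-- Exponential moment method: $u+1\le e^u$ at $u=an/p-1$ gives $n^p\le(p/a)^p e^{-p}e^{an}$. Since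
$E e^{aN}=\exp(e^a-1)$, the choice $a=\ln(p+1)$ gives exactly $e^p$, which cancels $e^{-p}$. -/
theorem tsum_weight_mul_rpow_le {p : ℝ} (hp : 1 ≤ p) :
    ∑' n : ℕ, weight n * ENNReal.ofReal ((n : ℝ) ^ p)
      ≤ ENNReal.ofReal ((p / Real.log (p + 1)) ^ p) := by
  set a := Real.log (p + 1) with ha
  have ha0 : 0 < a := Real.log_pos (by linarith)
  have hp0 : 0 < p := by linarith
  have hea : Real.exp a = p + 1 := Real.exp_log (by linarith)
  have hpt : ∀ n : ℕ, (n : ℝ) ^ p ≤ (p / a) ^ p * (Real.exp (-p) * (p + 1) ^ n) := by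
    intro n
    have h1 : (n : ℝ) ≤ p / a * Real.exp (a * n / p - 1) := by
      have := Real.add_one_le_exp (a * n / p - 1)
      calc (n : ℝ) = p / a * (a * n / p - 1 + 1) := by field_simp; ring
        _ ≤ _ := by gcongr
    calc (n : ℝ) ^ p ≤ (p / a * Real.exp (a * n / p - 1)) ^ p :=
          Real.rpow_le_rpow (by positivity) h1 hp0.le
      _ = (p / a) ^ p * (Real.exp (-p) * (p + 1) ^ n) := by
          rw [Real.mul_rpow (by positivity) (by positivity), ← Real.exp_mul, ← hea,
            ← Real.exp_nat_mul, ← Real.exp_add]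
          congr 2
          field_simp
          ring
  refine ENNReal.tsum_le_of_sum_range_le fun N => ?_
  simp only [weight]
  rw [Finset.sum_congr rfl fun n _ => (ENNReal.ofReal_mul (by positivity)).symm,
    ← ENNReal.ofReal_sum_of_nonneg fun n _ => by positivity]
  refine ENNReal.ofReal_le_ofReal ?_
  calc ∑ n ∈ Finset.range N, 1 / (Real.exp 1 * (n.factorial : ℝ)) * (n : ℝ) ^ p
      ≤ ∑ n ∈ Finset.range N, 1 / (Real.exp 1 * (n.factorial : ℝ)) *
          ((p / a) ^ p * (Real.exp (-p) * (p + 1) ^ n)) := by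
        gcongr with n _
        exact hpt n
    _ = (p / a) ^ p * Real.exp (-(p + 1)) *
          ∑ n ∈ Finset.range N, (p + 1) ^ n / (n.factorial : ℝ) := by
        rw [Finset.mul_sum]
        refine Finset.sum_congr rfl fun n _ => ?_
        rw [show -(p + 1) = -p + -1 by ring, Real.exp_add, Real.exp_neg 1]
        field_simp
    _ ≤ (p / a) ^ p * Real.exp (-(p + 1)) * Real.exp (p + 1) := by
        gcongr
        exact Real.sum_le_exp_of_nonneg (by linarith) N
    _ = (p / a) ^ p := by
        rw [mul_assoc, ← Real.exp_add]
        simp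

/-! ### Convex functions of the Kruglov operator -/

theorem lintegral_mul_indicator_eval {B : ℕ → Set unitInterval} (hB : IsPoissonSets B) {k n : ℕ}
    (hk : 1 ≤ k) (hn : 1 ≤ n) {F : unitInterval → ℝ≥0∞} (hF : AEMeasurable F volume) :
    ∫⁻ ω, F (ω k) * (B n).indicator (fun _ => (1 : ℝ≥0∞)) (ω 0) ∂prodMeasure
      = (∫⁻ x, F x) * weight n := by
  have hG : AEMeasurable ((B n).indicator (fun _ => (1 : ℝ≥0∞)))
      (volume : Measure unitInterval) :=
    aemeasurable_const.indicator₀ (hB.nullMeasurableSet n hn)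
  have hind : IndepFun (fun ω : Omega => ω k) (fun ω : Omega => ω 0) prodMeasure :=
    (iIndepFun_infinitePi (P := fun _ : ℕ => (volume : Measure unitInterval))
      (X := fun _ x => x) (fun _ => measurable_id)).indepFun (by omega)
  have hk' := measurePreserving_eval k
  have h0' := measurePreserving_eval 0
  have hind2 := IndepFun.comp₀ (φ := F) (ψ := (B n).indicator (fun _ => (1 : ℝ≥0∞)))
      hind hk'.aemeasurable h0'.aemeasurable (by rw [hk'.map_eq]; exact hF)
      (by rw [h0'.map_eq]; exact hG)
  refine (lintegral_mul_eq_lintegral_mul_lintegral_of_indepFun''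
    (hF.comp_quasiMeasurePreserving hk'.quasiMeasurePreserving)
    (hG.comp_quasiMeasurePreserving h0'.quasiMeasurePreserving) hind2).trans ?_
  congr 1
  · have := lintegral_map' (μ := prodMeasure) (g := fun ω : Omega => ω k)
      (by rw [hk'.map_eq]; exact hF) hk'.aemeasurable
    rw [hk'.map_eq] at this
    exact this.symm
  · have := lintegral_map' (μ := prodMeasure) (g := fun ω : Omega => ω 0)
      (by rw [h0'.map_eq]; exact hG) h0'.aemeasurable
    rw [h0'.map_eq] at this
    refine this.symm.trans ?_
    rw [weight, ← hB.volume_eq n hn]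
    exact lintegral_indicator_one₀ (hB.nullMeasurableSet n hn)

theorem kruglovTerm_eq_zero {B : ℕ → Set unitInterval} (f : unitInterval → ℝ) {n : ℕ} {ω : Omega}
    (h : ¬ (1 ≤ n ∧ ω 0 ∈ B n)) : kruglovTerm B f n ω = 0 := by
  refine Finset.sum_eq_zero fun k hk => ?_
  have h1 : 1 ≤ n := (Finset.mem_Icc.1 hk).1.trans (Finset.mem_Icc.1 hk).2
  have h2 : ω 0 ∉ B n := fun h' => h ⟨h1, h'⟩
  simp [h2]

/-- By disjointness at most one $n$ is active at each $\omega$. Hypothesis `hconv` is Jensen's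
inequality with equal weights; where no $B_n$ is hit, $Kf=0$ and $\varphi(0)=0$ is needed. -/
theorem comp_enorm_kruglovFun_le {B : ℕ → Set unitInterval} (hB : IsPoissonSets B)
    (f : unitInterval → ℝ) {φ : ℝ≥0∞ → ℝ≥0∞} (hφ0 : φ 0 = 0) (hφ : Monotone φ)
    (hconv : ∀ n : ℕ, 1 ≤ n → ∀ x : ℕ → ℝ≥0∞,
      φ (∑ k ∈ Finset.Icc 1 n, x k) ≤ (n : ℝ≥0∞)⁻¹ * ∑ k ∈ Finset.Icc 1 n, φ (n * x k))
    (ω : Omega) :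
    φ ‖kruglovFun B f ω‖ₑ ≤ ∑' n : ℕ, (n : ℝ≥0∞)⁻¹ * ∑ k ∈ Finset.Icc 1 n,
      φ (n * ‖f (ω k)‖ₑ) * (B n).indicator (fun _ => (1 : ℝ≥0∞)) (ω 0) := by
  by_cases h : ∃ m, 1 ≤ m ∧ ω 0 ∈ B m
  · obtain ⟨m, hm1, hm⟩ := h
    have e : kruglovFun B f ω = ∑ k ∈ Finset.Icc 1 m, f (ω k) := by
      rw [kruglovFun, tsum_eq_single m fun n hn => kruglovTerm_eq_zero f ?_]
      · simp [kruglovTerm, hm]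
      · rintro ⟨h1, h2⟩
        exact Set.disjoint_left.1 (hB.disjoint n m h1 hm1 hn) h2 hm
    refine le_trans ?_ (ENNReal.le_tsum m)
    simp only [Set.indicator_of_mem hm, mul_one]
    rw [e]
    exact (hφ (enorm_sum_le _ _)).trans (hconv m hm1 fun k => ‖f (ω k)‖ₑ)
  · have e : kruglovFun B f ω = 0 := by
      rw [kruglovFun, tsum_congr fun n => kruglovTerm_eq_zero f fun h' => h ⟨n, h'⟩, tsum_zero]
    rw [e, enorm_zero, hφ0]
    exact zero_le

theorem lintegral_comp_enorm_kruglovFun_le {B : ℕ → Set unitInterval} (hB : IsPoissonSets B)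
    {f : unitInterval → ℝ} (hf : AEMeasurable f volume) {φ : ℝ≥0∞ → ℝ≥0∞}
    (hφ0 : φ 0 = 0) (hφ : Monotone φ)
    (hconv : ∀ n : ℕ, 1 ≤ n → ∀ x : ℕ → ℝ≥0∞,
      φ (∑ k ∈ Finset.Icc 1 n, x k) ≤ (n : ℝ≥0∞)⁻¹ * ∑ k ∈ Finset.Icc 1 n, φ (n * x k)) :
    ∫⁻ ω, φ ‖kruglovFun B f ω‖ₑ ∂prodMeasure
      ≤ ∑' n : ℕ, weight n * ∫⁻ x, φ (n * ‖f x‖ₑ) := by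
  have hF : ∀ n : ℕ, AEMeasurable (fun x => φ (n * ‖f x‖ₑ)) (volume : Measure unitInterval) :=
    fun n => hφ.measurable.comp_aemeasurable (hf.enorm.const_mul _)
  have hmeas : ∀ n, ∀ k ∈ Finset.Icc 1 n, AEMeasurable (fun ω : Omega =>
      φ (n * ‖f (ω k)‖ₑ) * (B n).indicator (fun _ => (1 : ℝ≥0∞)) (ω 0)) prodMeasure := by
    intro n k hk
    have hn : 1 ≤ n := (Finset.mem_Icc.1 hk).1.trans (Finset.mem_Icc.1 hk).2
    exact ((hF n).comp_quasiMeasurePreserving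
        (measurePreserving_eval k).quasiMeasurePreserving).mul
      ((aemeasurable_const.indicator₀ (hB.nullMeasurableSet n hn)).comp_quasiMeasurePreserving
        (measurePreserving_eval 0).quasiMeasurePreserving)
  refine (lintegral_mono (comp_enorm_kruglovFun_le hB f hφ0 hφ hconv)).trans ?_
  rw [lintegral_tsum fun n => (Finset.aemeasurable_fun_sum _ (hmeas n)).const_mul _]
  refine ENNReal.tsum_le_tsum fun n => ?_
  rw [lintegral_const_mul'' _ (Finset.aemeasurable_fun_sum _ (hmeas n)),
    lintegral_finsetSum' _ (hmeas n)]
  -- For $n=0$ the left side is $\infty\cdot0=0$, the inner sum being empty.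
  rcases Nat.eq_zero_or_pos n with rfl | hn
  · simp
  rw [Finset.sum_congr rfl fun k hk =>
    lintegral_mul_indicator_eval hB (Finset.mem_Icc.1 hk).1 hn (hF n)]
  rw [Finset.sum_const, Nat.card_Icc, nsmul_eq_mul, Nat.add_sub_cancel, ← mul_assoc,
    ENNReal.inv_mul_cancel (by simpa using hn.ne') (ENNReal.natCast_ne_top n), one_mul, mul_comm]

/-! ### The operator norms -/

theorem lintegral_enorm_kruglovFun_rpow_le {B : ℕ → Set unitInterval} (hB : IsPoissonSets B)
    {f : unitInterval → ℝ} (hf : AEMeasurable f volume) {p : ℝ} (hp : 1 ≤ p) :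
    ∫⁻ ω, ‖kruglovFun B f ω‖ₑ ^ p ∂prodMeasure
      ≤ ENNReal.ofReal ((p / Real.log (p + 1)) ^ p) * ∫⁻ x, ‖f x‖ₑ ^ p := by
  have hp0 : 0 < p := by linarith
  refine (lintegral_comp_enorm_kruglovFun_le hB hf (φ := fun y => y ^ p)
    (ENNReal.zero_rpow_of_pos hp0) (ENNReal.monotone_rpow_of_nonneg hp0.le) ?_).trans ?_
  · intro n hn x
    have hn0 : (n : ℝ≥0∞) ≠ 0 := by simpa using (by omega : n ≠ 0)
    refine (ENNReal.rpow_sum_le_const_mul_sum_rpow _ _ hp).trans (le_of_eq ?_)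
    simp only [ENNReal.mul_rpow_of_nonneg _ _ hp0.le]
    rw [← Finset.mul_sum, ← mul_assoc, Nat.card_Icc, Nat.add_sub_cancel,
      ENNReal.rpow_sub _ _ hn0 (ENNReal.natCast_ne_top n), ENNReal.rpow_one, ENNReal.div_eq_inv_mul]
  · refine le_trans (le_of_eq ?_) (mul_le_mul_left (tsum_weight_mul_rpow_le hp) _)
    rw [← ENNReal.tsum_mul_right]
    refine tsum_congr fun n => ?_
    simp only [ENNReal.mul_rpow_of_nonneg _ _ hp0.le]
    rw [lintegral_const_mul'' _ (hf.enorm.pow_const p), mul_assoc,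
      ← ENNReal.ofReal_rpow_of_nonneg (Nat.cast_nonneg n) hp0.le, ENNReal.ofReal_natCast]

theorem coeFn_kruglov {B : ℕ → Set unitInterval} (hB : IsPoissonSets B)
    (f : Lp ℝ 1 (volume : Measure unitInterval)) :
    kruglov B hB f =ᵐ[prodMeasure] kruglovFun B f :=
  (integrable_kruglovFun hB (L1.integrable_coeFn f)).coeFn_toL1

theorem kruglovNormLp_le {B : ℕ → Set unitInterval} (hB : IsPoissonSets B) {p : ℝ} (hp : 1 ≤ p) :
    kruglovNormLp B hB p ≤ ENNReal.ofReal (p / Real.log (p + 1)) := by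
  have hp0 : 0 < p := by linarith
  have ha0 : 0 < Real.log (p + 1) := Real.log_pos (by linarith)
  refine sInf_le fun f _ => ?_
  beta_reduce
  rw [eLpNorm_congr_ae (coeFn_kruglov hB f),
    eLpNorm_eq_lintegral_rpow_enorm_toReal (by simpa using hp0) ENNReal.ofReal_ne_top,
    eLpNorm_eq_lintegral_rpow_enorm_toReal (by simpa using hp0) ENNReal.ofReal_ne_top,
    ENNReal.toReal_ofReal hp0.le]
  refine (ENNReal.rpow_le_rpow (lintegral_enorm_kruglovFun_rpow_le hB
    (Lp.aestronglyMeasurable f).aemeasurable hp) (by positivity)).trans (le_of_eq ?_)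
  rw [ENNReal.mul_rpow_of_nonneg _ _ (by positivity),
    ENNReal.ofReal_rpow_of_nonneg (by positivity) (by positivity), one_div,
    Real.rpow_rpow_inv (by positivity) hp0.ne']

/-- Only $E=\{n|f|>S\}$ contributes, and there $\int_E|f|\le F\mu(E)^{1-1/p}$. Young's inequality
splits this into a term in $n^p$ and $S\mu(E)$, which the subtraction of $S$ absorbs. -/
theorem lintegral_natCast_mul_enorm_tsub_le {α : Type*} [MeasurableSpace α] (μ : Measure α)
    [IsProbabilityMeasure μ] {f : α → ℝ} (hf : AEMeasurable f μ) {p : ℝ} (hp : 1 ≤ p)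
    (hfin : marcinkiewiczNorm μ (fun t => t ^ (1 / p)) f ≠ ∞) {σ : ℝ} (hσ : 0 < σ) (n : ℕ) :
    ∫⁻ x, (n * ‖f x‖ₑ - marcinkiewiczNorm μ (fun t => t ^ (1 / p)) f
        * ENNReal.ofReal (σ * (1 - 1 / p))) ∂μ
      ≤ marcinkiewiczNorm μ (fun t => t ^ (1 / p)) f
        * ENNReal.ofReal (σ * (1 / p * (n / σ) ^ p)) := by
  have hp0 : 0 < p := by linarith
  have hp1 : 0 ≤ 1 - 1 / p := by
    rw [sub_nonneg, div_le_one hp0]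
    exact hp
  set F := marcinkiewiczNorm μ (fun t => t ^ (1 / p)) f with hF
  set S := F * ENNReal.ofReal (σ * (1 - 1 / p)) with hS
  have hSt : S ≠ ∞ := ENNReal.mul_ne_top hfin ENNReal.ofReal_ne_top
  rcases Nat.eq_zero_or_pos n with rfl | hn
  · simp
  have hn0 : (n : ℝ≥0∞) ≠ 0 := by simpa using hn.ne'
  have hnt : (n : ℝ≥0∞) ≠ ∞ := ENNReal.natCast_ne_top n
  have hns : NullMeasurableSet {x | S / n < ‖f x‖ₑ} μ :=
    nullMeasurableSet_lt aemeasurable_const hf.enorm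
  set E := {x | S / n < ‖f x‖ₑ} with hE
  set τ := (μ E).toReal with hτ
  have hτ0 : 0 ≤ τ := ENNReal.toReal_nonneg
  have hμE : μ E = ENNReal.ofReal τ := (ENNReal.ofReal_toReal (measure_ne_top _ _)).symm
  -- Weighted AM-GM for $(n/\sigma)^p$ and $\tau$ with weights $1/p$ and $1-1/p$, multiplied by
  -- $\sigma$; the last term matches $S\tau$.
  have hyoung : (n : ℝ) * τ ^ (1 - 1 / p)
      ≤ σ * (1 / p * (n / σ) ^ p) + σ * (1 - 1 / p) * τ := by
    have := Real.geom_mean_le_arith_mean2_weighted (by positivity) hp1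
      (Real.rpow_nonneg (by positivity : 0 ≤ (n : ℝ) / σ) p) hτ0 (add_sub_cancel (1 / p) 1)
    rw [one_div, Real.rpow_rpow_inv (by positivity) hp0.ne', ← one_div] at this
    calc (n : ℝ) * τ ^ (1 - 1 / p) = σ * (n / σ * τ ^ (1 - 1 / p)) := by field_simp
      _ ≤ σ * (1 / p * (n / σ) ^ p + (1 - 1 / p) * τ) := by gcongr
      _ = _ := by ring
  have hsplit : ∫⁻ x, (n * ‖f x‖ₑ - S) ∂μ = ∫⁻ x in E, (n * ‖f x‖ₑ - S) ∂μ := by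
    rw [← lintegral_indicator₀ hns]
    refine lintegral_congr fun x => ?_
    by_cases hx : x ∈ E
    · rw [Set.indicator_of_mem hx]
    · rw [Set.indicator_of_notMem hx, tsub_eq_zero_iff_le, mul_comm,
        ← ENNReal.le_div_iff_mul_le (Or.inl hn0) (Or.inl hnt)]
      exact not_lt.1 hx
  -- Subtraction is truncated, so $S\mu(E)$ is added to both sides and cancelled at the end;
  -- finiteness of $F$ permits this.
  have hmain : ∫⁻ x in E, (n * ‖f x‖ₑ - S) ∂μ + S * μ E
      ≤ F * ENNReal.ofReal (σ * (1 / p * (n / σ) ^ p)) + S * μ E := by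
    calc ∫⁻ x in E, (n * ‖f x‖ₑ - S) ∂μ + S * μ E
        = ∫⁻ x in E, n * ‖f x‖ₑ ∂μ := by
          rw [← setLIntegral_const, ← lintegral_add_right _ measurable_const,
            ← lintegral_indicator₀ hns, ← lintegral_indicator₀ hns]
          refine lintegral_congr fun x => ?_
          by_cases hx : x ∈ E
          · rw [Set.indicator_of_mem hx, Set.indicator_of_mem hx, tsub_add_cancel_of_le]
            rw [mul_comm, ← ENNReal.div_le_iff hn0 hnt]
            exact le_of_lt hx
          · rw [Set.indicator_of_notMem hx, Set.indicator_of_notMem hx]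
      _ = n * ∫⁻ x in E, ‖f x‖ₑ ∂μ := lintegral_const_mul' _ _ hnt
      _ ≤ n * (F * ENNReal.ofReal (τ ^ (1 - 1 / p))) := by
          gcongr
          exact setLIntegral_enorm_le_marcinkiewiczNorm μ hf p _
      _ = F * ENNReal.ofReal (n * τ ^ (1 - 1 / p)) := by
          rw [ENNReal.ofReal_mul (by positivity), ENNReal.ofReal_natCast]
          ring
      _ ≤ F * ENNReal.ofReal (σ * (1 / p * (n / σ) ^ p) + σ * (1 - 1 / p) * τ) := by
          gcongr
      _ = _ := by
          rw [ENNReal.ofReal_add (by positivity) (by positivity), mul_add, hμE, hS,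
            mul_assoc F, ← ENNReal.ofReal_mul (by positivity)]
  rw [hsplit]
  exact (ENNReal.add_le_add_iff_right
    (ENNReal.mul_ne_top hSt (measure_ne_top _ _))).1 hmain

theorem kruglovNormMarcinkiewicz_le {B : ℕ → Set unitInterval} (hB : IsPoissonSets B) {p : ℝ}
    (hp : 1 ≤ p) :
    kruglovNormMarcinkiewicz B hB (fun t : ℝ => t ^ (1 / p))
      ≤ ENNReal.ofReal (p / Real.log (p + 1)) := by
  have hp0 : 0 < p := by linarith
  have hp1 : 0 ≤ 1 - 1 / p := by
    rw [sub_nonneg, div_le_one hp0]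
    exact hp
  have ha0 : 0 < Real.log (p + 1) := Real.log_pos (by linarith)
  refine sInf_le fun f hfin => ?_
  have hf : AEMeasurable f volume := (Lp.aestronglyMeasurable f).aemeasurable
  beta_reduce at hfin ⊢
  rw [marcinkiewiczNorm_congr_ae _ (coeFn_kruglov hB f)]
  set F := marcinkiewiczNorm volume (fun t : ℝ => t ^ (1 / p)) f with hF
  set M := p / Real.log (p + 1) with hM
  have hM0 : 0 < M := by positivity
  refine iSup₂_le fun t ht => ?_
  have ht0 : 0 < t := ht.1
  -- This $\sigma$ satisfies $\sigma^p=M^p/t$, so the summed term in $n^p$ becomes $F\sigma t/p$.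
  -- Adding $St=F\sigma t(1-1/p)$ gives $F\sigma t$, and $t^{1/p-1}\sigma t=M$.
  set σ := M * t ^ (-(1 / p)) with hσ
  have hσ0 : 0 < σ := by positivity
  have hσp : σ ^ p = M ^ p / t := by
    rw [hσ, Real.mul_rpow hM0.le (by positivity), ← Real.rpow_mul ht0.le]
    rw [show -(1 / p) * p = -1 by field_simp, Real.rpow_neg_one, div_eq_mul_inv]
  set S := F * ENNReal.ofReal (σ * (1 - 1 / p)) with hS
  have hK : ∫⁻ ω, (‖kruglovFun B f ω‖ₑ - S) ∂prodMeasure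
      ≤ F * ENNReal.ofReal (σ * (1 / p) * t) := by
    refine (lintegral_comp_enorm_kruglovFun_le hB hf (φ := fun y => y - S) (zero_tsub S)
      (fun _ _ h => tsub_le_tsub_right h S) ?_).trans ?_
    -- Convexity of $y\mapsto(y-S)_+$: average the bounds $nx_k\le(nx_k-S)_++S$ over $k$.
    · intro n hn x
      have hn0 : (n : ℝ≥0∞) ≠ 0 := by simpa using (by omega : n ≠ 0)
      have hnt : (n : ℝ≥0∞) ≠ ∞ := ENNReal.natCast_ne_top n
      rw [tsub_le_iff_right]
      calc ∑ k ∈ Finset.Icc 1 n, x k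
          = (n : ℝ≥0∞)⁻¹ * ∑ k ∈ Finset.Icc 1 n, n * x k := by
            rw [← Finset.mul_sum, ← mul_assoc, ENNReal.inv_mul_cancel hn0 hnt, one_mul]
        _ ≤ (n : ℝ≥0∞)⁻¹ * ∑ k ∈ Finset.Icc 1 n, ((n * x k - S) + S) := by
            gcongr
            exact le_tsub_add
        _ = _ := by
            rw [Finset.sum_add_distrib, Finset.sum_const, Nat.card_Icc, Nat.add_sub_cancel,
              nsmul_eq_mul, mul_add, ← mul_assoc _ (n : ℝ≥0∞) S, ENNReal.inv_mul_cancel hn0 hnt,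
              one_mul]
    · calc ∑' n : ℕ, weight n * ∫⁻ x, (n * ‖f x‖ₑ - S)
          ≤ ∑' n : ℕ, weight n * (F * ENNReal.ofReal (σ * (1 / p * (n / σ) ^ p))) := by
            gcongr with n
            exact lintegral_natCast_mul_enorm_tsub_le volume hf hp hfin.ne hσ0 n
        _ = ∑' n : ℕ, (weight n * ENNReal.ofReal ((n : ℝ) ^ p))
              * (F * ENNReal.ofReal (σ * (1 / p) / σ ^ p)) := by
            refine tsum_congr fun n => ?_
            rw [Real.div_rpow (Nat.cast_nonneg n) hσ0.le,
              show σ * (1 / p * ((n : ℝ) ^ p / σ ^ p)) = (n : ℝ) ^ p * (σ * (1 / p) / σ ^ p) by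
                ring, ENNReal.ofReal_mul (by positivity)]
            ring
        _ ≤ ENNReal.ofReal (M ^ p) * (F * ENNReal.ofReal (σ * (1 / p) / σ ^ p)) := by
            rw [ENNReal.tsum_mul_right]
            gcongr
            exact tsum_weight_mul_rpow_le hp
        _ = F * ENNReal.ofReal (σ * (1 / p) * t) := by
            rw [mul_left_comm, ← ENNReal.ofReal_mul (by positivity), hσp]
            congr 2
            have := (Real.rpow_pos_of_pos hM0 p).ne'
            field_simp
  calc ENNReal.ofReal (t ^ (1 / p) / t) *
        ∫⁻ s in Set.Ioc (0 : ℝ) t, rearrangement prodMeasure (kruglovFun B f) s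
      ≤ ENNReal.ofReal (t ^ (1 / p) / t) *
          (S * ENNReal.ofReal t + F * ENNReal.ofReal (σ * (1 / p) * t)) := by
        gcongr
        exact (setLIntegral_rearrangement_le prodMeasure
          (aestronglyMeasurable_kruglovFun hB hf.aestronglyMeasurable).aemeasurable ht.2 S).trans
          (add_le_add_right hK _)
    _ = ENNReal.ofReal M * F := by
        rw [hS, mul_assoc, ← ENNReal.ofReal_mul (by positivity), ← mul_add,
          ← ENNReal.ofReal_add (by positivity) (by positivity), mul_left_comm,
          ← ENNReal.ofReal_mul (by positivity), mul_comm]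
        congr 2
        have hinv : t ^ (1 / p) * t ^ (-(1 / p)) = 1 := by
          rw [← Real.rpow_add ht0]
          simp
        calc t ^ (1 / p) / t * (σ * (1 - 1 / p) * t + σ * (1 / p) * t)
            = M * (t ^ (1 / p) * t ^ (-(1 / p))) * (t / t) := by rw [hσ]; ring
          _ = M := by rw [hinv, div_self ht0.ne', mul_one, mul_one]

end Kruglov

theorem corollary4p2 :
    ∃ C : ℝ, 0 < C ∧
      ∀ (B : ℕ → Set unitInterval) (hB : Kruglov.IsPoissonSets B) (p : ℝ), 1 ≤ p →
        Kruglov.kruglovNormLp B hB p ≤ ENNReal.ofReal (C * p / Real.log (p + 1)) ∧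
        Kruglov.kruglovNormMarcinkiewicz B hB (fun t : ℝ => t ^ (1 / p)) ≤
          ENNReal.ofReal (C * p / Real.log (p + 1)) := by
  refine ⟨1, one_pos, fun B hB p hp => ?_⟩
  rw [one_mul]
  exact ⟨Kruglov.kruglovNormLp_le hB hp, Kruglov.kruglovNormMarcinkiewicz_le hB hp⟩
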